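/- All quantum systems are finite-dimensional, $S(\rho)=-\operatorname{Tr}\rho\log_2\rho$ is the von Neumann entropy, $I(P:Q)_\tau=S(P)_\tau+S(Q)_\tau-S(PQ)_\tau$ is the quantum mutual information and $I(P\rangle Q)_\tau=S(Q)_\tau-S(PQ)_\tau$ is the coherent information of a state $\tau^{PQ}$ (entropies of subsystems being those of the reduced states). For a cq state $\rho^{ARX}=\sum_x p(x)\,\rho_x^{AR}\otimes|x\rangle\langle x|^X$, where $p$ is a probability distribution on a finite set and every $\rho_x^{AR}$ is a density operator (for instance a pure state $|\rho_x\rangle\langle\rho_x|^{AR}$), and a quantum channel (completely positive trace-preserving linear map) $\mathcal N:A\to B$, the generalized information is $$I_G(\rho^{ARX},\mathcal N):=I(B:X)_\sigma+I(R\rangle BX)_\sigma,\qquad \sigma^{BRX}=(\mathcal N\otimes\mathrm{id}_{RX})(\rho^{ARX})=\sum_x p(x)\,(\mathcal N\otimes\mathrm{id}_R)(\rho_x^{AR})\otimes|x\rangle\langle x|^X .$$ Then the generalized information satisfies the data-processing inequality: for all quantum channels $\mathcal N_1:A\to B$ and $\mathcal N_2:B\to C$ and every cq state $\rho^{ARX}$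 as above, $$I_G(\rho^{ARX},\mathcal N_2\circ\mathcal N_1)\;\le\; I_G(\rho^{ARX},\mathcal N_1).$$ -/

import Mathlib

open scoped Kronecker ComplexOrder

noncomputable section

namespace QInfo

/-! A finite-dimensional quantum system is a finite index type `A` labelling an orthonormal basis;
operators on it are complex `A × A` matrices, and the composite of `P` and `Q` is `P × Q`. -/

/-- Density operators: positive semidefinite matrices of trace one. -/
def IsDensity {A : Type*} [Fintype A] (ρ : Matrix A A ℂ) : Prop :=
  ρ.PosSemidef ∧ ρ.trace = 1

/-- `Φ ⊗ id_R`, for a linear map `Φ` from operators on `A` to operators on `B`. -/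
def tensorId {A B : Type*} (R : Type*) (Φ : Matrix A A ℂ →ₗ[ℂ] Matrix B B ℂ) :
    Matrix (A × R) (A × R) ℂ →ₗ[ℂ] Matrix (B × R) (B × R) ℂ where
  toFun M := Matrix.of fun i j => Φ (Matrix.of fun a a' => M (a, i.2) (a', j.2)) i.1 j.1
  map_add' M N := by
    ext i j
    exact congrFun (congrFun (map_add Φ (Matrix.of fun a a' => M (a, i.2) (a', j.2))
      (Matrix.of fun a a' => N (a, i.2) (a', j.2))) i.1) j.1
  map_smul' c M := by
    ext i j
    exact congrFun (congrFun (map_smul Φ c (Matrix.of fun a a' => M (a, i.2) (a', j.2))) i.1) j.1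

/-- `tensorId R Φ` acts on product operators as `Φ ⊗ id_R` must. -/
theorem tensorId_kronecker {A B R : Type*} (Φ : Matrix A A ℂ →ₗ[ℂ] Matrix B B ℂ)
    (M : Matrix A A ℂ) (N : Matrix R R ℂ) : tensorId R Φ (M ⊗ₖ N) = Φ M ⊗ₖ N := by
  ext i j
  have h : (Matrix.of fun a a' => (M ⊗ₖ N) (a, i.2) (a', j.2)) = N i.2 j.2 • M := by
    ext a a'
    simp [Matrix.kroneckerMap_apply, mul_comm]
  change Φ (Matrix.of fun a a' => (M ⊗ₖ N) (a, i.2) (a', j.2)) i.1 j.1 = _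
  rw [h, map_smul]
  simp [Matrix.kroneckerMap_apply, mul_comm]

/-- Complete positivity: `Φ ⊗ id` maps positive semidefinite operators to positive semidefinite
operators, for an ancilla of every finite dimension. -/
def IsCompletelyPositive {A B : Type*} (Φ : Matrix A A ℂ →ₗ[ℂ] Matrix B B ℂ) : Prop :=
  ∀ (k : ℕ) (M : Matrix (A × Fin k) (A × Fin k) ℂ),
    M.PosSemidef → (tensorId (Fin k) Φ M).PosSemidef

/-- Quantum channels: completely positive trace-preserving linear maps. -/
def IsChannel {A B : Type*} [Fintype A] [Fintype B]
    (Φ : Matrix A A ℂ →ₗ[ℂ] Matrix B B ℂ) : Prop :=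
  IsCompletelyPositive Φ ∧ ∀ M : Matrix A A ℂ, (Φ M).trace = M.trace

/-- The partial trace `Tr_P` of an operator on `P ⊗ Q`. -/
def traceFst {P Q : Type*} [Fintype P] (M : Matrix (P × Q) (P × Q) ℂ) : Matrix Q Q ℂ :=
  Matrix.of fun i j => ∑ p, M (p, i) (p, j)

/-- The partial trace `Tr_Q` of an operator on `P ⊗ Q`. -/
def traceSnd {P Q : Type*} [Fintype Q] (M : Matrix (P × Q) (P × Q) ℂ) : Matrix P P ℂ :=
  Matrix.of fun i j => ∑ q, M (i, q) (j, q)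

/-- The von Neumann entropy `S(ρ) = -Tr (ρ log ρ)`, with the binary logarithm; the logarithm is
taken by functional calculus (with `0 log 0 = 0`). -/
def entropy {A : Type*} [Fintype A] [DecidableEq A] (ρ : Matrix A A ℂ) : ℝ :=
  -(Matrix.trace (ρ * cfc (Real.logb 2) ρ)).re

/-- The quantum mutual information `I(P:Q)_τ = S(P)_τ + S(Q)_τ - S(PQ)_τ`. -/
def mutualInfo {P Q : Type*} [Fintype P] [DecidableEq P] [Fintype Q] [DecidableEq Q]
    (τ : Matrix (P × Q) (P × Q) ℂ) : ℝ :=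
  entropy (traceSnd τ) + entropy (traceFst τ) - entropy τ

/-- The coherent information `I(P⟩Q)_τ = S(Q)_τ - S(PQ)_τ`. -/
def coherentInfo {P Q : Type*} [Fintype P] [DecidableEq P] [Fintype Q] [DecidableEq Q]
    (τ : Matrix (P × Q) (P × Q) ℂ) : ℝ :=
  entropy (traceFst τ) - entropy τ

/-- The operator `∑ₓ p(x) ρₓ ⊗ |x⟩⟨x|` on `S ⊗ X`. -/
def cqState {S X : Type*} [Fintype X] [DecidableEq X] (p : X → ℝ) (ρ : X → Matrix S S ℂ) :
    Matrix (S × X) (S × X) ℂ :=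
  ∑ x, (p x : ℂ) • (ρ x ⊗ₖ Matrix.single x x (1 : ℂ))

/-- An operator on `(B ⊗ R) ⊗ X`, with the tensor factors rearranged as `R ⊗ (B ⊗ X)`. -/
def regroup {B R X : Type*} (σ : Matrix ((B × R) × X) ((B × R) × X) ℂ) :
    Matrix (R × (B × X)) (R × (B × X)) ℂ :=
  σ.submatrix (fun i => ((i.2.1, i.1), i.2.2)) (fun i => ((i.2.1, i.1), i.2.2))

/-- The generalized information `I_G(ρ^{ARX}, N) = I(B:X)_σ + I(R⟩BX)_σ`, where
`σ^{BRX} = (N ⊗ id_R ⊗ id_X) ρ^{ARX}`. -/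
def generalizedInfo {A B R X : Type*} [Fintype B] [DecidableEq B] [Fintype R] [DecidableEq R]
    [Fintype X] [DecidableEq X] (ρ : Matrix ((A × R) × X) ((A × R) × X) ℂ)
    (N : Matrix A A ℂ →ₗ[ℂ] Matrix B B ℂ) : ℝ :=
  mutualInfo (traceFst (regroup (tensorId X (tensorId R N) ρ))) +
    coherentInfo (regroup (tensorId X (tensorId R N) ρ))

/-- On a cq state, `σ^{BRX}` is `∑ₓ p(x) (N ⊗ id_R)(ρₓ) ⊗ |x⟩⟨x|`. -/
theorem tensorId_cqState {A B R X : Type*} [Fintype X] [DecidableEq X]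
    (N : Matrix A A ℂ →ₗ[ℂ] Matrix B B ℂ) (p : X → ℝ) (ρ : X → Matrix (A × R) (A × R) ℂ) :
    tensorId X (tensorId R N) (cqState p ρ) = cqState p fun x => tensorId R N (ρ x) := by
  simp only [cqState, map_sum, map_smul, tensorId_kronecker]

end QInfo

end

/-!
In `I(B:X) + I(R⟩BX)` the two terms `S(BX)` cancel, so the generalized information is
`S(X) + S(B) - S(BRX)`. A trace-preserving map on `A` leaves the state of `X` unchanged, so the
claim is the data-processing inequality for the coherent information `S(B) - S(BE)` with `E = RX`,
under a channel `N : B → C`, where `τ` is a positive semidefinite operator on `BE`. Since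
`S(B) - S(BE)` is the relative entropy `D(τ ‖ τ_B ⊗ 1)` and `N ⊗ id_E` maps `τ_B ⊗ 1` to
`N(τ_B) ⊗ 1`, it follows from monotonicity of the relative entropy under `N ⊗ id_E`.

Monotonicity is proved by Petz's method. Up to a divergent term that depends only on `Tr ρ`,
`D(ρ ‖ σ)` is the integral over `t > 0` of the quadratic form
`∑ᵢⱼ |⟨uᵢ, vⱼ⟩|² rⱼ² / (sᵢ + t rⱼ)`, where `sᵢ, uᵢ` and `rⱼ, vⱼ` are the eigenvalues and
eigenvectors of `σ` and `ρ` (`tendsto_logSum_sub`). For fixed `t` this form is the maximum over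
operators `X` of `2 Re Tr(ρ Xᴴ) - Tr(σ X Xᴴ) - t Tr(ρ Xᴴ X)` (`petzForm_le`, `exists_petzForm_eq`).
By the Kadison–Schwarz inequality for the adjoint `N†` of the channel, the functional at `X` after
the channel is at most the functional at `N†(X)` before it (`petzForm_krausMap_le`), so the maximum
can only decrease. The Kraus operators used here come from Choi's theorem
(`IsChannel.exists_kraus`).

No state needs to be invertible: the relative entropies that occur satisfy the support condition,
and under it the terms with `sᵢ = 0` vanish on both sides.
-/

open scoped Kronecker ComplexOrder

noncomputable section

namespace QInfo

open Matrix Filter Topology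

/-! ### Relative entropy in spectral coordinates -/

section Scalar

variable {m n : Type*} [Fintype m] [Fintype n]

/-- The quadratic form `⟨ρ^{1/2}, (Δ + t)⁻¹ ρ^{1/2}⟩` of the resolvent of the relative modular
operator `Δ : X ↦ σ X ρ⁻¹`, where `s` and `r` are the spectra of `σ` and `ρ` and `w i j` is the
squared overlap of the `i`-th eigenvector of `σ` with the `j`-th eigenvector of `ρ`. -/
def resolventSum (w : m → n → ℝ) (s : m → ℝ) (r : n → ℝ) (t : ℝ) : ℝ :=
  ∑ i, ∑ j, w i j * (r j ^ 2 / (s i + t * r j))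

/-- The integral of `resolventSum w s r` over `[0, t]`. An index with `s i = 0` contributes `0`, as
it must if `w i j * r j = 0` for that `i`, since `r j / 0 = 0` by convention. -/
def logSum (w : m → n → ℝ) (s : m → ℝ) (r : n → ℝ) (t : ℝ) : ℝ :=
  ∑ i, ∑ j, w i j * (r j * Real.log (1 + t * (r j / s i)))

/-- The relative entropy `Tr ρ (log ρ - log σ)`, with the natural logarithm, in terms of the spectra
and squared overlaps of `σ` and `ρ`. It is the relative entropy only if the support of `ρ` lies in
that of `σ`, that is, if `w i j * r j = 0` whenever `s i = 0`. -/
def relEntSum (w : m → n → ℝ) (s : m → ℝ) (r : n → ℝ) : ℝ :=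
  ∑ i, ∑ j, w i j * (r j * (Real.log (r j) - Real.log (s i)))

variable {w : m → n → ℝ} {s : m → ℝ} {r : n → ℝ}

theorem hasDerivAt_logSum (hs : ∀ i, 0 ≤ s i) (hr : ∀ j, 0 ≤ r j)
    (h0 : ∀ i j, s i = 0 → w i j * r j = 0) {t : ℝ} (ht : 0 ≤ t) :
    HasDerivAt (logSum w s r) (resolventSum w s r t) t := by
  refine HasDerivAt.fun_sum fun i _ => HasDerivAt.fun_sum fun j _ => ?_
  rcases (hs i).eq_or_lt with hi | hi
  · have hw := h0 i j hi.symm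
    have h1 : (fun t => w i j * (r j * Real.log (1 + t * (r j / s i)))) = fun _ => 0 := by
      funext t
      rw [← mul_assoc, hw, zero_mul]
    have h2 : w i j * (r j ^ 2 / (s i + t * r j)) = 0 := by
      rw [pow_two, mul_div_assoc, ← mul_assoc, hw, zero_mul]
    rw [h1, h2]
    exact hasDerivAt_const _ _
  · have hpos : 0 < 1 + t * (r j / s i) := by
      have := mul_nonneg ht (div_nonneg (hr j) hi.le)
      linarith
    have hpos' : 0 < s i + t * r j := by
      have := mul_nonneg ht (hr j)
      linarith
    have h := ((((hasDerivAt_id t).mul_const (r j / s i)).const_add 1).log hpos.ne').const_mul (r j)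
      |>.const_mul (w i j)
    refine h.congr_deriv ?_
    simp only [id, one_mul]
    have : 1 + t * (r j / s i) = (s i + t * r j) / s i := by field_simp
    rw [this]
    field_simp

/-- The regularised integral formula `log a = ∫₀^∞ (a / (1 + t a) - 1 / (1 + t)) dt`, summed over
the spectra with `a = r j / s i`. -/
theorem tendsto_logSum_sub (hs : ∀ i, 0 ≤ s i) (hr : ∀ j, 0 ≤ r j)
    (h0 : ∀ i j, s i = 0 → w i j * r j = 0) :
    Tendsto (fun t => logSum w s r t - (∑ i, ∑ j, w i j * r j) * Real.log (1 + t)) atTop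
      (𝓝 (relEntSum w s r)) := by
  have key : ∀ a : ℝ, 0 < a →
      Tendsto (fun t => Real.log (1 + t * a) - Real.log (1 + t)) atTop (𝓝 (Real.log a)) := by
    intro a ha
    have h1 : Tendsto (fun t : ℝ => (1 + t)⁻¹) atTop (𝓝 0) :=
      tendsto_inv_atTop_zero.comp (tendsto_atTop_add_const_left _ _ tendsto_id)
    have h2 : Tendsto (fun t : ℝ => a + (1 - a) * (1 + t)⁻¹) atTop (𝓝 a) := by
      simpa using (h1.const_mul (1 - a)).const_add a
    refine ((Real.continuousAt_log ha.ne').tendsto.comp h2).congr' ?_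
    filter_upwards [eventually_ge_atTop 0] with t ht
    have h3 : 0 < 1 + t * a := by positivity
    have h4 : 0 < 1 + t := by positivity
    rw [← Real.log_div h3.ne' h4.ne', Function.comp_apply]
    congr 1
    field_simp
    ring
  have hsum : ∀ t, logSum w s r t - (∑ i, ∑ j, w i j * r j) * Real.log (1 + t) =
      ∑ i, ∑ j, w i j * r j * (Real.log (1 + t * (r j / s i)) - Real.log (1 + t)) := by
    intro t
    simp only [logSum, Finset.sum_mul, ← Finset.sum_sub_distrib]
    refine Finset.sum_congr rfl fun i _ => Finset.sum_congr rfl fun j _ => ?_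
    ring
  simp only [hsum, relEntSum, ← mul_assoc]
  refine tendsto_finsetSum _ fun i _ => tendsto_finsetSum _ fun j _ => ?_
  rcases eq_or_ne (w i j * r j) 0 with hw | hw
  · simp [hw]
  · have hsi : 0 < s i := (hs i).lt_of_ne fun h => hw (h0 i j h.symm)
    have hrj : 0 < r j := (hr j).lt_of_ne fun h => hw (by rw [← h, mul_zero])
    rw [← Real.log_div hrj.ne' hsi.ne']
    exact (key _ (div_pos hrj hsi)).const_mul _

/-- A comparison of the resolvent forms at every `t > 0` integrates to a comparison of relative
entropies; equality of the total weights cancels the divergent part of the integrals. -/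
theorem relEntSum_le_of_resolventSum_le {m' n' : Type*} [Fintype m'] [Fintype n']
    {w' : m' → n' → ℝ} {s' : m' → ℝ} {r' : n' → ℝ}
    (hs : ∀ i, 0 ≤ s i) (hr : ∀ j, 0 ≤ r j) (h0 : ∀ i j, s i = 0 → w i j * r j = 0)
    (hs' : ∀ i, 0 ≤ s' i) (hr' : ∀ j, 0 ≤ r' j) (h0' : ∀ i j, s' i = 0 → w' i j * r' j = 0)
    (hmass : ∑ i, ∑ j, w' i j * r' j = ∑ i, ∑ j, w i j * r j)
    (hle : ∀ t, 0 < t → resolventSum w' s' r' t ≤ resolventSum w s r t) :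
    relEntSum w' s' r' ≤ relEntSum w s r := by
  have hderiv : ∀ t, 0 ≤ t → HasDerivAt (fun t => logSum w s r t - logSum w' s' r' t)
      (resolventSum w s r t - resolventSum w' s' r' t) t := fun t ht =>
    (hasDerivAt_logSum hs hr h0 ht).sub (hasDerivAt_logSum hs' hr' h0' ht)
  have hmono : MonotoneOn (fun t => logSum w s r t - logSum w' s' r' t) (Set.Ici 0) := by
    refine monotoneOn_of_deriv_nonneg (convex_Ici 0)
      (fun t ht => (hderiv t ht).continuousAt.continuousWithinAt) ?_ ?_
    · rw [interior_Ici]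
      exact fun t ht => (hderiv t (le_of_lt ht)).differentiableAt.differentiableWithinAt
    · rw [interior_Ici]
      intro t ht
      rw [(hderiv t (le_of_lt ht)).deriv]
      exact sub_nonneg.2 (hle t ht)
  refine le_of_tendsto_of_tendsto (tendsto_logSum_sub hs' hr' h0') (tendsto_logSum_sub hs hr h0) ?_
  filter_upwards [eventually_ge_atTop 0] with t ht
  have h := hmono Set.self_mem_Ici ht ht
  have hz : logSum w s r 0 - logSum w' s' r' 0 = 0 := by simp [logSum]
  simp only [hz] at h
  rw [hmass]
  linarith

end Scalar

/-! ### The variational form of the resolvent -/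

section Form

variable {n : Type*} [Fintype n] [DecidableEq n]

/-- `M = U diag(r) Uᴴ` with `U` unitary: the columns of `U` are an orthonormal eigenbasis of `M`,
with eigenvalues `r`. -/
structure Diagonalizes (U : Matrix n n ℂ) (r : n → ℝ) (M : Matrix n n ℂ) : Prop where
  unitary : Uᴴ * U = 1
  eq : M = U * diagonal (fun i => (r i : ℂ)) * Uᴴ

theorem Diagonalizes.unitary' {U : Matrix n n ℂ} {r : n → ℝ} {M : Matrix n n ℂ}
    (h : Diagonalizes U r M) : U * Uᴴ = 1 := mul_eq_one_comm.1 h.unitary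

/-- The squared modulus of the inner product of the `i`-th column of `U` and the `j`-th column of
`V`. -/
def overlap (U V : Matrix n n ℂ) (i j : n) : ℝ := Complex.normSq ((Uᴴ * V) i j)

/-- The concave functional `2 Re Tr(ρ Xᴴ) - Tr(σ X Xᴴ) - t Tr(ρ Xᴴ X)` of `X`, whose maximum is the
resolvent form of the relative modular operator. Unlike the latter it involves no inverse, and it
compares well under channels. -/
def petzForm {n : Type*} [Fintype n] (ρ σ : Matrix n n ℂ) (t : ℝ) (X : Matrix n n ℂ) : ℝ :=
  2 * (trace (ρ * Xᴴ)).re - (trace (σ * (X * Xᴴ))).re - t * (trace (ρ * (Xᴴ * X))).re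

variable {ρ σ U V : Matrix n n ℂ} {s r : n → ℝ}

theorem re_trace_diagonal_mul (d : n → ℝ) (M : Matrix n n ℂ) :
    (trace (diagonal (fun i => (d i : ℂ)) * M)).re = ∑ i, d i * (M i i).re := by
  simp [trace, diagonal_mul]

/-- In the eigenbases of `σ` and `ρ` the functional decouples into one scalar quadratic per entry
of `Y`. -/
theorem petzForm_eq_sum (hσ : Diagonalizes U s σ) (hρ : Diagonalizes V r ρ) (t : ℝ)
    (Y : Matrix n n ℂ) :
    petzForm ρ σ t (U * Y * Vᴴ) =
      ∑ i, ∑ j, (2 * (r j * (star (Y i j) * (Uᴴ * V) i j).re)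
        - (s i + t * r j) * Complex.normSq (Y i j)) := by
  have h1 : trace (ρ * (U * Y * Vᴴ)ᴴ) =
      trace (diagonal (fun i => (r i : ℂ)) * (Yᴴ * (Uᴴ * V))) := by
    rw [hρ.eq, trace_mul_comm _ (Yᴴ * (Uᴴ * V) : Matrix n n ℂ),
      trace_mul_comm _ ((U * Y * Vᴴ)ᴴ)]
    simp only [conjTranspose_mul, conjTranspose_conjTranspose, Matrix.mul_assoc]
    rw [trace_mul_comm V]
    simp only [Matrix.mul_assoc, hρ.unitary, Matrix.mul_one]
  have h2 : trace (σ * (U * Y * Vᴴ * (U * Y * Vᴴ)ᴴ)) =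
      trace (diagonal (fun i => (s i : ℂ)) * (Y * Yᴴ)) := by
    have : U * Y * Vᴴ * (U * Y * Vᴴ)ᴴ = U * (Y * Yᴴ) * Uᴴ := by
      simp only [conjTranspose_mul, conjTranspose_conjTranspose, Matrix.mul_assoc]
      rw [← Matrix.mul_assoc Vᴴ V, hρ.unitary, Matrix.one_mul]
    rw [this, hσ.eq, trace_mul_comm]
    simp only [Matrix.mul_assoc]
    rw [trace_mul_comm U]
    simp only [Matrix.mul_assoc, hσ.unitary, Matrix.mul_one]
    rw [← Matrix.mul_assoc Uᴴ U, hσ.unitary, Matrix.one_mul, ← Matrix.mul_assoc, trace_mul_comm]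
  have h3 : trace (ρ * ((U * Y * Vᴴ)ᴴ * (U * Y * Vᴴ))) =
      trace (diagonal (fun i => (r i : ℂ)) * (Yᴴ * Y)) := by
    have : (U * Y * Vᴴ)ᴴ * (U * Y * Vᴴ) = V * (Yᴴ * Y) * Vᴴ := by
      simp only [conjTranspose_mul, conjTranspose_conjTranspose, Matrix.mul_assoc]
      rw [← Matrix.mul_assoc Uᴴ U, hσ.unitary, Matrix.one_mul]
    rw [this, hρ.eq, trace_mul_comm]
    simp only [Matrix.mul_assoc]
    rw [trace_mul_comm V]
    simp only [Matrix.mul_assoc, hρ.unitary, Matrix.mul_one]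
    rw [← Matrix.mul_assoc Vᴴ V, hρ.unitary, Matrix.one_mul, ← Matrix.mul_assoc, trace_mul_comm]
  rw [petzForm, h1, h2, h3, re_trace_diagonal_mul, re_trace_diagonal_mul, re_trace_diagonal_mul]
  have e1 : ∀ j, ((Yᴴ * (Uᴴ * V)) j j).re = ∑ i, (star (Y i j) * (Uᴴ * V) i j).re := fun j => by
    rw [mul_apply, Complex.re_sum]
    rfl
  have e2 : ∀ i, ((Y * Yᴴ) i i).re = ∑ j, Complex.normSq (Y i j) := fun i => by
    rw [mul_apply, Complex.re_sum]
    exact Finset.sum_congr rfl fun j _ => by simp [Complex.normSq_apply]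
  have e3 : ∀ j, ((Yᴴ * Y) j j).re = ∑ i, Complex.normSq (Y i j) := fun j => by
    rw [mul_apply, Complex.re_sum]
    exact Finset.sum_congr rfl fun j _ => by simp [Complex.normSq_apply]
  simp only [e1, e2, e3, Finset.mul_sum]
  rw [Finset.sum_comm (f := fun j i => 2 * (r j * (star (Y i j) * (Uᴴ * V) i j).re)),
    Finset.sum_comm (f := fun j i => t * (r j * Complex.normSq (Y i j))),
    ← Finset.sum_sub_distrib, ← Finset.sum_sub_distrib]
  refine Finset.sum_congr rfl fun i _ => ?_
  rw [← Finset.sum_sub_distrib, ← Finset.sum_sub_distrib]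
  exact Finset.sum_congr rfl fun j _ => by ring

theorem two_mul_sub_le_div {a b : ℝ} (hb : 0 ≤ b) (h : b = 0 → a = 0) (z w : ℂ) :
    2 * (a * (star z * w).re) - b * Complex.normSq z ≤ Complex.normSq w * (a ^ 2 / b) := by
  rcases hb.eq_or_lt with hb | hb
  · simp [h hb.symm, ← hb]
  · -- After multiplication by `b` the difference of the two sides is `|b z - a w|²`.
    rw [← mul_div_assoc, le_div_iff₀ hb]
    simp only [Complex.normSq_apply, Complex.mul_re, Complex.star_def, Complex.conj_re,
      Complex.conj_im]
    nlinarith [sq_nonneg (b * z.re - a * w.re), sq_nonneg (b * z.im - a * w.im)]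

theorem two_mul_sub_eq_div (a b : ℝ) (w : ℂ) :
    2 * (a * (star ((a / b : ℝ) * w) * w).re) - b * Complex.normSq ((a / b : ℝ) * w) =
      Complex.normSq w * (a ^ 2 / b) := by
  rcases eq_or_ne b 0 with rfl | hb
  · simp
  · simp only [Complex.normSq_apply, Complex.mul_re, Complex.mul_im, Complex.star_def,
      Complex.conj_re, Complex.conj_im, Complex.ofReal_re, Complex.ofReal_im]
    field_simp
    ring

theorem petzForm_le (hσ : Diagonalizes U s σ) (hρ : Diagonalizes V r ρ) (hs : ∀ i, 0 ≤ s i)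
    (hr : ∀ j, 0 ≤ r j) {t : ℝ} (ht : 0 < t) (X : Matrix n n ℂ) :
    petzForm ρ σ t X ≤ resolventSum (overlap U V) s r t := by
  have hX : X = U * (Uᴴ * X * V) * Vᴴ := by
    simp only [Matrix.mul_assoc, hρ.unitary', Matrix.mul_one]
    rw [← Matrix.mul_assoc, hσ.unitary', Matrix.one_mul]
  rw [hX, petzForm_eq_sum hσ hρ]
  refine Finset.sum_le_sum fun i _ => Finset.sum_le_sum fun j _ =>
    two_mul_sub_le_div (add_nonneg (hs i) (mul_nonneg ht.le (hr j))) (fun h => ?_) _ _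
  have h1 := hs i
  have h2 := mul_nonneg ht.le (hr j)
  exact (mul_eq_zero.1 (by linarith : t * r j = 0)).resolve_left ht.ne'

/-- The maximiser has the entries `r j / (s i + t * r j) * (Uᴴ * V) i j` in the eigenbases; where
the denominator vanishes, the quotient is `0` by convention and so is the corresponding summand. -/
theorem exists_petzForm_eq (hσ : Diagonalizes U s σ) (hρ : Diagonalizes V r ρ) (t : ℝ) :
    ∃ X, petzForm ρ σ t X = resolventSum (overlap U V) s r t := by
  refine ⟨U * (of fun i j => ((r j / (s i + t * r j) : ℝ) : ℂ) * (Uᴴ * V) i j) * Vᴴ, ?_⟩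
  rw [petzForm_eq_sum hσ hρ]
  exact Finset.sum_congr rfl fun i _ => Finset.sum_congr rfl fun j _ => two_mul_sub_eq_div _ _ _

/-- The outcome probabilities of a measurement of `ρ` in the basis `U`. -/
theorem sum_overlap_mul (hρ : Diagonalizes V r ρ) (i : n) :
    ∑ j, overlap U V i j * r j = ((Uᴴ * ρ * U) i i).re := by
  have h : Uᴴ * ρ * U = (Uᴴ * V) * diagonal (fun i => (r i : ℂ)) * (Uᴴ * V)ᴴ := by
    rw [hρ.eq]
    simp only [conjTranspose_mul, conjTranspose_conjTranspose, Matrix.mul_assoc]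
  rw [h, mul_apply, Complex.re_sum]
  refine Finset.sum_congr rfl fun j _ => ?_
  simp only [overlap, mul_diagonal, conjTranspose_apply, Complex.normSq_apply, Complex.mul_re,
    Complex.star_def, Complex.conj_re, Complex.conj_im, Complex.mul_im, Complex.ofReal_re,
    Complex.ofReal_im]
  ring

theorem sum_overlap (hσ : U * Uᴴ = 1) (hρ : Vᴴ * V = 1) (j : n) :
    ∑ i, overlap U V i j = 1 := by
  have h : (Uᴴ * V)ᴴ * (Uᴴ * V) = 1 := by
    simp only [conjTranspose_mul, conjTranspose_conjTranspose, Matrix.mul_assoc]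
    rw [← Matrix.mul_assoc U, hσ, Matrix.one_mul, hρ]
  have h' := congrArg Complex.re (congrFun (congrFun h j) j)
  rw [mul_apply, Complex.re_sum, one_apply_eq, Complex.one_re] at h'
  rw [← h']
  exact Finset.sum_congr rfl fun i _ => by simp [overlap, Complex.normSq_apply]

theorem overlap_mul_eq_zero (hρ : Diagonalizes V r ρ) (hr : ∀ j, 0 ≤ r j) {i : n}
    (h : ((Uᴴ * ρ * U) i i).re = 0) (j : n) : overlap U V i j * r j = 0 := by
  rw [← sum_overlap_mul hρ] at h
  exact (Finset.sum_eq_zero_iff_of_nonneg fun j _ =>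
    mul_nonneg (Complex.normSq_nonneg _) (hr j)).1 h j (Finset.mem_univ j)

theorem sum_sum_overlap_mul (hσ : Diagonalizes U s σ) (hρ : Diagonalizes V r ρ) :
    ∑ i, ∑ j, overlap U V i j * r j = (trace ρ).re := by
  simp only [sum_overlap_mul hρ]
  rw [← Complex.re_sum]
  change (trace (Uᴴ * ρ * U)).re = _
  rw [trace_mul_comm, ← Matrix.mul_assoc, hσ.unitary', Matrix.one_mul]

theorem Diagonalizes.posSemidef (h : Diagonalizes U s σ) (hs : ∀ i, 0 ≤ s i) :
    σ.PosSemidef := by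
  rw [h.eq]
  refine PosSemidef.mul_mul_conjTranspose_same (PosSemidef.diagonal fun i => ?_) U
  simpa using hs i

end Form

/-! ### Monotonicity of the relative entropy -/

section Kraus

variable {m n κ : Type*} [Fintype m] [Fintype n] [Fintype κ] [DecidableEq n]

theorem re_trace_mul_mul_conjTranspose_nonneg {n : Type*} [Fintype n] {σ : Matrix n n ℂ}
    (hσ : σ.PosSemidef) {l : Type*} [Fintype l]
    (Z : Matrix n l ℂ) : 0 ≤ (trace (σ * (Z * Zᴴ))).re := by
  rw [← Matrix.mul_assoc, trace_mul_comm, ← Matrix.mul_assoc]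
  exact (Complex.le_def.1 (hσ.conjTranspose_mul_mul_same Z).trace_nonneg).1

theorem trace_krausMap_mul {n : Type*} [Fintype n] (K : κ → Matrix m n ℂ) (M : Matrix n n ℂ)
    (X : Matrix m m ℂ) :
    trace ((∑ k, K k * M * (K k)ᴴ) * X) = trace (M * ∑ k, (K k)ᴴ * X * K k) := by
  simp only [Finset.sum_mul, Finset.mul_sum, trace_sum]
  refine Finset.sum_congr rfl fun k _ => ?_
  rw [Matrix.mul_assoc, Matrix.mul_assoc, trace_mul_comm (K k)]
  simp only [Matrix.mul_assoc]

/-- The Kadison–Schwarz inequality `N†(X) N†(X)ᴴ ≤ N†(X Xᴴ)` for the unital adjoint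
`N† X = ∑ₖ Kₖᴴ X Kₖ` of a channel, tested against a positive semidefinite `σ`. -/
theorem kadison_schwarz {K : κ → Matrix m n ℂ} (hK : ∑ k, (K k)ᴴ * K k = 1) {σ : Matrix n n ℂ}
    (hσ : σ.PosSemidef) (X : Matrix m m ℂ) :
    (trace (σ * ((∑ k, (K k)ᴴ * X * K k) * (∑ k, (K k)ᴴ * X * K k)ᴴ))).re ≤
      (trace ((∑ k, K k * σ * (K k)ᴴ) * (X * Xᴴ))).re := by
  set Y := ∑ k, (K k)ᴴ * X * K k with hY
  have hY' : Yᴴ = ∑ k, (K k)ᴴ * Xᴴ * K k := by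
    simp [hY, conjTranspose_sum, Matrix.mul_assoc]
  -- The defect in the operator inequality is an explicit sum of squares.
  have key : ∑ k, (K k)ᴴ * (X * Xᴴ) * K k =
      Y * Yᴴ + ∑ k, ((K k)ᴴ * X - Y * (K k)ᴴ) * ((K k)ᴴ * X - Y * (K k)ᴴ)ᴴ := by
    have h : ∀ k, ((K k)ᴴ * X - Y * (K k)ᴴ) * ((K k)ᴴ * X - Y * (K k)ᴴ)ᴴ =
        (K k)ᴴ * (X * Xᴴ) * K k - (K k)ᴴ * X * K k * Yᴴ - Y * ((K k)ᴴ * Xᴴ * K k)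
          + Y * ((K k)ᴴ * K k) * Yᴴ := fun k => by
      simp only [conjTranspose_sub, conjTranspose_mul, conjTranspose_conjTranspose,
        Matrix.sub_mul, Matrix.mul_sub, Matrix.mul_assoc]
      abel
    simp only [h, Finset.sum_add_distrib, Finset.sum_sub_distrib]
    rw [← Finset.sum_mul, ← Finset.mul_sum, ← Finset.sum_mul, ← Finset.mul_sum, hK, ← hY, ← hY',
      Matrix.mul_one]
    abel
  rw [trace_krausMap_mul, key, Matrix.mul_add, trace_add, Complex.add_re, Finset.mul_sum,
    trace_sum, Complex.re_sum]
  exact le_add_of_nonneg_right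
    (Finset.sum_nonneg fun k _ => re_trace_mul_mul_conjTranspose_nonneg hσ _)

/-- A test operator `X` after the channel is no better than its image under the adjoint before the
channel: the linear term is unchanged, and both quadratic terms obey the Kadison–Schwarz
inequality. -/
theorem petzForm_krausMap_le {K : κ → Matrix m n ℂ} (hK : ∑ k, (K k)ᴴ * K k = 1)
    {ρ σ : Matrix n n ℂ} (hρ : ρ.PosSemidef) (hσ : σ.PosSemidef) {t : ℝ} (ht : 0 ≤ t)
    (X : Matrix m m ℂ) :
    petzForm (∑ k, K k * ρ * (K k)ᴴ) (∑ k, K k * σ * (K k)ᴴ) t X ≤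
      petzForm ρ σ t (∑ k, (K k)ᴴ * X * K k) := by
  have hadj : ∀ X : Matrix m m ℂ, ∑ k, (K k)ᴴ * Xᴴ * K k = (∑ k, (K k)ᴴ * X * K k)ᴴ := fun X => by
    simp [conjTranspose_sum, Matrix.mul_assoc]
  have h1 := kadison_schwarz hK hσ X
  have h2 := kadison_schwarz hK hρ Xᴴ
  rw [hadj, conjTranspose_conjTranspose, conjTranspose_conjTranspose] at h2
  rw [petzForm, petzForm, trace_krausMap_mul K ρ Xᴴ, hadj]
  have h3 := mul_le_mul_of_nonneg_left h2 ht
  linarith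

/-- Monotonicity of the relative entropy under the channel with Kraus operators `K`, for states
given by diagonalizations. The hypotheses `h0` and `h0'` say that the support of `ρ` lies in that of
`σ`, before and after the channel. -/
theorem relEntSum_krausMap_le [DecidableEq m] {K : κ → Matrix m n ℂ}
    (hK : ∑ k, (K k)ᴴ * K k = 1)
    {ρ σ U V : Matrix n n ℂ} {s r : n → ℝ} {U' V' : Matrix m m ℂ} {s' r' : m → ℝ}
    (hσ : Diagonalizes U s σ) (hρ : Diagonalizes V r ρ) (hs : ∀ i, 0 ≤ s i) (hr : ∀ j, 0 ≤ r j)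
    (h0 : ∀ i, s i = 0 → ((Uᴴ * ρ * U) i i).re = 0)
    (hσ' : Diagonalizes U' s' (∑ k, K k * σ * (K k)ᴴ))
    (hρ' : Diagonalizes V' r' (∑ k, K k * ρ * (K k)ᴴ))
    (hs' : ∀ i, 0 ≤ s' i) (hr' : ∀ j, 0 ≤ r' j)
    (h0' : ∀ i, s' i = 0 → ((U'ᴴ * (∑ k, K k * ρ * (K k)ᴴ) * U') i i).re = 0) :
    relEntSum (overlap U' V') s' r' ≤ relEntSum (overlap U V) s r := by
  refine relEntSum_le_of_resolventSum_le hs hr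
    (fun i j h => overlap_mul_eq_zero hρ hr (h0 i h) j) hs' hr'
    (fun i j h => overlap_mul_eq_zero hρ' hr' (h0' i h) j) ?_ fun t ht => ?_
  · rw [sum_sum_overlap_mul hσ hρ, sum_sum_overlap_mul hσ' hρ']
    have h := trace_krausMap_mul K ρ 1
    simp only [Matrix.mul_one, hK] at h
    rw [h]
  · -- The maximiser after the channel pulls back to a competitor before it.
    obtain ⟨X, hX⟩ := exists_petzForm_eq hσ' hρ' t
    rw [← hX]
    exact (petzForm_krausMap_le hK (hρ.posSemidef hr) (hσ.posSemidef hs) ht.le X).trans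
      (petzForm_le hσ hρ hs hr ht _)

theorem relEntSum_overlap {n : Type*} [Fintype n] [DecidableEq n] {ρ U V : Matrix n n ℂ}
    {s r : n → ℝ} (hU : U * Uᴴ = 1) (hρ : Diagonalizes V r ρ) :
    relEntSum (overlap U V) s r =
      ∑ j, r j * Real.log (r j) - ∑ i, ((Uᴴ * ρ * U) i i).re * Real.log (s i) := by
  simp only [relEntSum, mul_sub, Finset.sum_sub_distrib, ← sum_overlap_mul hρ, Finset.sum_mul]
  congr 1
  · rw [Finset.sum_comm]
    refine Finset.sum_congr rfl fun j _ => ?_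
    rw [← Finset.sum_mul, sum_overlap hU hρ.unitary, one_mul]
  · simp only [mul_assoc]

end Kraus

/-! ### Entropy and spectrum -/

section Entropy

variable {m n : Type*} [Fintype m] [DecidableEq m] [Fintype n] [DecidableEq n]

theorem diagonalizes_eigenvectorUnitary {M : Matrix n n ℂ} (hM : M.IsHermitian) :
    Diagonalizes (hM.eigenvectorUnitary : Matrix n n ℂ) hM.eigenvalues M where
  unitary := mem_unitaryGroup_iff'.1 hM.eigenvectorUnitary.2
  eq := by
    conv_lhs => rw [hM.spectral_theorem, Unitary.conjStarAlgAut_apply]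
    rfl

theorem entropy_eq_sum_eigenvalues {M : Matrix n n ℂ} (hM : M.IsHermitian) :
    entropy M = -(∑ i, hM.eigenvalues i * Real.log (hM.eigenvalues i)) / Real.log 2 := by
  have h : M * cfc (Real.logb 2) M = Unitary.conjStarAlgAut ℂ _ hM.eigenvectorUnitary
      (diagonal fun i => ((hM.eigenvalues i * Real.logb 2 (hM.eigenvalues i) : ℝ) : ℂ)) := by
    rw [hM.cfc_eq, IsHermitian.cfc]
    conv_lhs =>
      enter [1]
      rw [hM.spectral_theorem]
    rw [← map_mul, diagonal_mul_diagonal]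
    congr 2
    funext i
    simp
  rw [entropy, h, Unitary.conjStarAlgAut_apply, trace_mul_comm, ← Matrix.mul_assoc,
    Unitary.coe_star_mul_self, Matrix.one_mul, trace_diagonal, Complex.re_sum, neg_div,
    Finset.sum_div]
  simp only [Complex.ofReal_re, Real.logb, mul_div_assoc]

theorem exists_diagonalizes {M : Matrix n n ℂ} (hM : M.PosSemidef) :
    ∃ (U : Matrix n n ℂ) (s : n → ℝ), Diagonalizes U s M ∧ (∀ i, 0 ≤ s i) ∧
      entropy M = -(∑ i, s i * Real.log (s i)) / Real.log 2 :=
  ⟨_, _, diagonalizes_eigenvectorUnitary hM.1, hM.eigenvalues_nonneg,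
    entropy_eq_sum_eigenvalues hM.1⟩

theorem entropy_eq_sum_roots_charpoly {M : Matrix n n ℂ} (hM : M.IsHermitian) :
    entropy M = -(M.charpoly.roots.map fun z => z.re * Real.log z.re).sum / Real.log 2 := by
  rw [entropy_eq_sum_eigenvalues hM, hM.roots_charpoly_eq_eigenvalues, Multiset.map_map]
  rfl

theorem entropy_submatrix_equiv {M : Matrix n n ℂ} (hM : M.IsHermitian) (e : m ≃ n) :
    entropy (M.submatrix e e) = entropy M := by
  have hc : (M.submatrix e e).charpoly = M.charpoly := charpoly_reindex e.symm M
  rw [entropy_eq_sum_roots_charpoly hM, entropy_eq_sum_roots_charpoly (hM.submatrix e), hc]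

end Entropy

/-! ### Partial traces -/

section PartialTrace

variable {B C E : Type*} [Fintype E]

theorem posSemidef_traceSnd {M : Matrix (B × E) (B × E) ℂ} (hM : M.PosSemidef) :
    (traceSnd M).PosSemidef := by
  have h : traceSnd M = ∑ e, M.submatrix (fun b => (b, e)) (fun b => (b, e)) := by
    ext i j
    simp [traceSnd, Matrix.sum_apply]
  rw [h]
  exact posSemidef_sum _ fun e _ => hM.submatrix _

theorem traceSnd_kronecker_one_mul_mul [Fintype B] [DecidableEq E] (K L : Matrix C B ℂ)
    (M : Matrix (B × E) (B × E) ℂ) :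
    traceSnd ((K ⊗ₖ (1 : Matrix E E ℂ)) * M * (L ⊗ₖ (1 : Matrix E E ℂ))ᴴ) =
      K * traceSnd M * Lᴴ := by
  ext i j
  simp only [traceSnd, of_apply, mul_apply, kroneckerMap_apply, conjTranspose_apply,
    Fintype.sum_prod_type, one_apply, Finset.sum_mul, Finset.mul_sum, mul_ite, ite_mul, mul_one,
    mul_zero, zero_mul, Finset.sum_ite_eq, Finset.mem_univ, if_true, apply_ite star, star_zero]
  rw [Finset.sum_comm]
  refine Finset.sum_congr rfl fun b _ => ?_
  rw [Finset.sum_comm]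

theorem traceSnd_tensorId (Φ : Matrix B B ℂ →ₗ[ℂ] Matrix C C ℂ) (M : Matrix (B × E) (B × E) ℂ) :
    traceSnd (tensorId E Φ M) = Φ (traceSnd M) := by
  have h : traceSnd M = ∑ e, of fun b b' => M (b, e) (b', e) := by
    ext i j
    simp [traceSnd, Matrix.sum_apply]
  rw [h, map_sum]
  ext i j
  simp [traceSnd, tensorId, Matrix.sum_apply]

end PartialTrace

/-! ### Kraus representation of channels -/

section Kraus

variable {B C : Type*}

/-- Choi's theorem: the image of the maximally entangled vector under `Φ ⊗ id` is a sum of rank-one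
operators `uₖ uₖᴴ`, and the `uₖ`, read as matrices, are Kraus operators of `Φ`. -/
theorem IsChannel.exists_kraus [Fintype B] [Fintype C] [DecidableEq B]
    {Φ : Matrix B B ℂ →ₗ[ℂ] Matrix C C ℂ} (hΦ : IsChannel Φ) :
    ∃ (m : ℕ) (K : Fin m → Matrix C B ℂ),
      (∀ M, Φ M = ∑ k, K k * M * (K k)ᴴ) ∧ ∑ k, (K k)ᴴ * K k = 1 := by
  let e := Fintype.equivFin B
  -- `v` is the unnormalised maximally entangled vector.
  let v : B × Fin (Fintype.card B) → ℂ := fun i => if e i.1 = i.2 then 1 else 0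
  have hΩ := hΦ.1 (Fintype.card B) _ (posSemidef_vecMulVec_self_star v)
  -- The Choi matrix, its ancilla relabelled by `B`.
  have hchoi : (tensorId (Fin (Fintype.card B)) Φ (vecMulVec v (star v))).submatrix
      (Prod.map id e : C × B → _) (Prod.map id e) =
      of fun i j => Φ (single i.2 j.2 1) i.1 j.1 := by
    ext ⟨c, b⟩ ⟨c', b'⟩
    have hm : of (fun a a' => vecMulVec v (star v) (a, e b) (a', e b')) = single b b' (1 : ℂ) := by
      ext a a'
      simp only [of_apply, vecMulVec_apply, v, Pi.star_apply, EmbeddingLike.apply_eq_iff_eq,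
        single_apply, apply_ite star, star_one, star_zero]
      by_cases h1 : b = a <;> by_cases h2 : b' = a' <;> simp [h1, h2, eq_comm]
    exact congrArg (fun Y => Φ Y c c') hm
  have hpsd := hΩ.submatrix (Prod.map id e : C × B → C × Fin (Fintype.card B))
  rw [hchoi] at hpsd
  obtain ⟨m, u, hu⟩ := posSemidef_iff_eq_sum_vecMulVec.1 hpsd
  have hent : ∀ b b' c c', Φ (single b b' 1) c c' = ∑ k, u k (c, b) * star (u k (c', b')) :=
    fun b b' c c' => by
      have h := congrFun (congrFun hu (c, b)) (c', b')
      simpa [Matrix.sum_apply, vecMulVec_apply] using h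
  refine ⟨m, fun k => of fun c b => u k (c, b), fun M => ?_, ?_⟩
  · conv_lhs => rw [matrix_eq_sum_single M]
    have hs : ∀ b b', single b b' (M b b') = M b b' • single b b' (1 : ℂ) := fun b b' => by simp
    simp only [map_sum, hs, map_smul]
    ext c c'
    simp only [Matrix.sum_apply, Matrix.smul_apply, hent, mul_apply, of_apply, conjTranspose_apply,
      smul_eq_mul, Finset.mul_sum, Finset.sum_mul]
    rw [Finset.sum_comm_cycle]
    refine Finset.sum_congr rfl fun k _ => ?_
    rw [Finset.sum_comm]
    exact Finset.sum_congr rfl fun b' _ => Finset.sum_congr rfl fun b _ => by ring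
  · ext b b'
    have h := hΦ.2 (single b' b 1)
    have h' : trace (Φ (single b' b 1)) = ∑ k, ∑ c, star (u k (c, b)) * u k (c, b') := by
      simp only [Matrix.trace, diag_apply, hent, mul_comm (star _)]
      exact Finset.sum_comm
    rw [h'] at h
    simp only [Matrix.sum_apply, mul_apply, conjTranspose_apply, of_apply]
    rw [h]
    rcases eq_or_ne b b' with rfl | hb
    · rw [trace_single_eq_same, one_apply_eq]
    · rw [trace_single_eq_of_ne _ _ _ hb.symm, one_apply_ne hb]

theorem tensorId_eq_sum_kraus {κ E : Type*} [Fintype B] [Fintype κ] [Fintype E] [DecidableEq E]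
    {Φ : Matrix B B ℂ →ₗ[ℂ] Matrix C C ℂ} {K : κ → Matrix C B ℂ}
    (hK : ∀ M, Φ M = ∑ k, K k * M * (K k)ᴴ) (M : Matrix (B × E) (B × E) ℂ) :
    tensorId E Φ M =
      ∑ k, (K k ⊗ₖ (1 : Matrix E E ℂ)) * M * (K k ⊗ₖ (1 : Matrix E E ℂ))ᴴ := by
  ext ⟨c, x⟩ ⟨c', x'⟩
  change Φ (of fun a a' => M (a, x) (a', x')) c c' = _
  rw [hK]
  simp only [Matrix.sum_apply, of_apply, mul_apply, kroneckerMap_apply, conjTranspose_apply,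
    Fintype.sum_prod_type, one_apply, Finset.sum_mul, mul_ite, ite_mul, mul_one,
    mul_zero, zero_mul, Finset.sum_ite_eq, Finset.mem_univ, if_true, apply_ite star, star_zero]

theorem sum_kraus_kronecker_one {κ E : Type*} [Fintype C] [Fintype κ] [Fintype E]
    [DecidableEq E] [DecidableEq B] {K : κ → Matrix C B ℂ} (hK : ∑ k, (K k)ᴴ * K k = 1) :
    ∑ k, (K k ⊗ₖ (1 : Matrix E E ℂ))ᴴ * (K k ⊗ₖ (1 : Matrix E E ℂ)) = 1 := by
  simp only [conjTranspose_kronecker, ← mul_kronecker_mul, conjTranspose_one, Matrix.one_mul]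
  rw [← one_kronecker_one, ← hK]
  ext i j
  simp [Matrix.sum_apply, kroneckerMap_apply, Finset.sum_mul]

theorem IsChannel.posSemidef_tensorId {E : Type*} [Fintype B] [Fintype C] [Fintype E]
    {Φ : Matrix B B ℂ →ₗ[ℂ] Matrix C C ℂ} (hΦ : IsChannel Φ) {M : Matrix (B × E) (B × E) ℂ}
    (hM : M.PosSemidef) : (tensorId E Φ M).PosSemidef := by
  classical
  obtain ⟨m, K, hK, -⟩ := hΦ.exists_kraus
  rw [tensorId_eq_sum_kraus hK]
  exact posSemidef_sum _ fun k _ => hM.mul_mul_conjTranspose_same _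

end Kraus

/-! ### Data processing for the coherent information -/

section DataProcessing

variable {B C E : Type*} [Fintype B] [DecidableEq B] [Fintype C] [DecidableEq C]
  [Fintype E] [DecidableEq E]

theorem Diagonalizes.kronecker_one {U M : Matrix B B ℂ} {s : B → ℝ} (h : Diagonalizes U s M) :
    Diagonalizes (U ⊗ₖ (1 : Matrix E E ℂ)) (fun i => s i.1) (M ⊗ₖ (1 : Matrix E E ℂ)) where
  unitary := by
    rw [conjTranspose_kronecker, ← mul_kronecker_mul, h.unitary, conjTranspose_one,
      Matrix.one_mul, one_kronecker_one]
  eq := by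
    have hd : diagonal (fun i : B × E => ((s i.1 : ℝ) : ℂ)) =
        diagonal (fun b => (s b : ℂ)) ⊗ₖ (1 : Matrix E E ℂ) := by
      rw [← diagonal_one, diagonal_kronecker_diagonal]
      simp
    rw [hd, conjTranspose_kronecker, ← mul_kronecker_mul, ← mul_kronecker_mul, ← h.eq,
      conjTranspose_one, Matrix.one_mul, Matrix.one_mul]

/-- In an eigenbasis of the reduced operator on `B`, the diagonal entries of `τ` sum over `E` to the
eigenvalues of the reduced operator. -/
theorem sum_re_conj_kronecker_one {U : Matrix B B ℂ} {s : B → ℝ} {τ : Matrix (B × E) (B × E) ℂ}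
    (h : Diagonalizes U s (traceSnd τ)) (b : B) :
    ∑ e, (((U ⊗ₖ (1 : Matrix E E ℂ))ᴴ * τ * (U ⊗ₖ (1 : Matrix E E ℂ))) (b, e) (b, e)).re = s b := by
  have h1 := traceSnd_kronecker_one_mul_mul Uᴴ Uᴴ τ
  have h2 : Uᴴ * traceSnd τ * Uᴴᴴ = diagonal fun b => (s b : ℂ) := by
    rw [h.eq, conjTranspose_conjTranspose]
    simp only [Matrix.mul_assoc, h.unitary, Matrix.mul_one]
    rw [← Matrix.mul_assoc, h.unitary, Matrix.one_mul]
  have h3 : (U ⊗ₖ (1 : Matrix E E ℂ)) = (Uᴴ ⊗ₖ (1 : Matrix E E ℂ))ᴴ := by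
    rw [conjTranspose_kronecker, conjTranspose_conjTranspose, conjTranspose_one]
  have h4 := congrArg Complex.re (congrFun (congrFun (h1.trans h2) b) b)
  rw [diagonal_apply_eq, Complex.ofReal_re] at h4
  rw [← h4, h3, conjTranspose_conjTranspose, traceSnd, of_apply, Complex.re_sum]

/-- The support of `τ` lies in that of `traceSnd τ ⊗ 1`. -/
theorem re_conj_kronecker_one_eq_zero {U : Matrix B B ℂ} {s : B → ℝ}
    {τ : Matrix (B × E) (B × E) ℂ} (hτ : τ.PosSemidef) (h : Diagonalizes U s (traceSnd τ))
    (i : B × E) (hi : s i.1 = 0) :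
    (((U ⊗ₖ (1 : Matrix E E ℂ))ᴴ * τ * (U ⊗ₖ (1 : Matrix E E ℂ))) i i).re = 0 := by
  rw [← sum_re_conj_kronecker_one h] at hi
  exact (Finset.sum_eq_zero_iff_of_nonneg fun e _ =>
    (Complex.le_def.1 (hτ.conjTranspose_mul_mul_same _).diag_nonneg).1).1 hi i.2
      (Finset.mem_univ _)

/-- `D(τ ‖ τ_B ⊗ 1) = S(B) - S(BE)`, in natural units. -/
theorem relEntSum_kronecker_one_eq {τ V : Matrix (B × E) (B × E) ℂ} {r : B × E → ℝ}
    {U : Matrix B B ℂ} {s : B → ℝ} (hV : Diagonalizes V r τ) (hU : Diagonalizes U s (traceSnd τ)) :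
    relEntSum (overlap (U ⊗ₖ (1 : Matrix E E ℂ)) V) (fun i => s i.1) r =
      ∑ j, r j * Real.log (r j) - ∑ b, s b * Real.log (s b) := by
  rw [relEntSum_overlap (hU.kronecker_one (E := E)).unitary' hV]
  refine congrArg _ ((Fintype.sum_prod_type _).trans (Finset.sum_congr rfl fun b _ => ?_))
  exact (Finset.sum_mul _ _ _).symm.trans
    (congrArg (· * Real.log (s b)) (sum_re_conj_kronecker_one hU b))

/-- Data processing for the coherent information `I(E⟩B) = S(B) - S(BE)`: monotonicity of the
relative entropy `D(τ ‖ τ_B ⊗ 1)` under `N ⊗ id_E`, which maps `τ_B ⊗ 1` to `N(τ_B) ⊗ 1`. -/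
theorem entropy_traceSnd_sub_entropy_tensorId_le {τ : Matrix (B × E) (B × E) ℂ}
    (hτ : τ.PosSemidef) {N : Matrix B B ℂ →ₗ[ℂ] Matrix C C ℂ} (hN : IsChannel N) :
    entropy (traceSnd (tensorId E N τ)) - entropy (tensorId E N τ) ≤
      entropy (traceSnd τ) - entropy τ := by
  obtain ⟨m, K, hK, hK1⟩ := hN.exists_kraus
  have hτ' := hN.posSemidef_tensorId hτ
  have heq : traceSnd (tensorId E N τ) ⊗ₖ (1 : Matrix E E ℂ) =
      ∑ k, (K k ⊗ₖ (1 : Matrix E E ℂ)) * (traceSnd τ ⊗ₖ (1 : Matrix E E ℂ)) *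
        (K k ⊗ₖ (1 : Matrix E E ℂ))ᴴ := by
    rw [← tensorId_eq_sum_kraus hK, tensorId_kronecker, traceSnd_tensorId]
  obtain ⟨V, r, hV, hr, hSr⟩ := exists_diagonalizes hτ
  obtain ⟨U, s, hU, hs, hSs⟩ := exists_diagonalizes (posSemidef_traceSnd hτ)
  obtain ⟨V', r', hV', hr', hSr'⟩ := exists_diagonalizes hτ'
  obtain ⟨U', s', hU', hs', hSs'⟩ := exists_diagonalizes (posSemidef_traceSnd hτ')
  have h0' := re_conj_kronecker_one_eq_zero hτ' hU'
  have hUE' := hU'.kronecker_one (E := E)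
  have hV'' := hV'
  rw [heq] at hUE'
  rw [tensorId_eq_sum_kraus hK] at hV'' h0'
  have key := relEntSum_krausMap_le (sum_kraus_kronecker_one (E := E) hK1)
    (hU.kronecker_one (E := E)) hV (fun i => hs i.1) hr
    (re_conj_kronecker_one_eq_zero hτ hU) hUE' hV'' (fun i => hs' i.1) hr' h0'
  rw [relEntSum_kronecker_one_eq hV hU, relEntSum_kronecker_one_eq hV' hU'] at key
  rw [hSr, hSs, hSr', hSs', ← sub_div, ← sub_div]
  refine div_le_div_of_nonneg_right ?_ (Real.log_pos one_lt_two).le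
  linarith

end DataProcessing

/-! ### The generalized information -/

section GeneralizedInfo

variable {A B R X : Type*} [Fintype B] [Fintype R]

theorem posSemidef_cqState {S : Type*} [Finite S] [Fintype X] [DecidableEq X]
    {p : X → ℝ} (hp : ∀ x, 0 ≤ p x) {ρ : X → Matrix S S ℂ} (hρ : ∀ x, (ρ x).PosSemidef) :
    (cqState p ρ).PosSemidef := by
  refine posSemidef_sum _ fun x _ => PosSemidef.smul ((hρ x).kronecker ?_) ?_
  · rw [← diagonal_single]
    refine PosSemidef.diagonal fun i => ?_
    by_cases h : i = x <;> simp [h]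
  · exact_mod_cast hp x

/-- The state of `X` does not depend on the channel. -/
theorem traceFst_traceFst_regroup_tensorId [Fintype A] {N : Matrix A A ℂ →ₗ[ℂ] Matrix B B ℂ}
    (hN : IsChannel N) (ρ : Matrix ((A × R) × X) ((A × R) × X) ℂ) :
    traceFst (traceFst (regroup (tensorId X (tensorId R N) ρ))) =
      of fun x x' => ∑ r, ∑ a, ρ ((a, r), x) ((a, r), x') := by
  ext x x'
  change ∑ b, ∑ r, N (of fun a a' => ρ ((a, r), x) ((a', r), x')) b b = _
  rw [Finset.sum_comm]
  exact Finset.sum_congr rfl fun r _ => hN.2 (of fun a a' => ρ ((a, r), x) ((a', r), x'))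

/-- `S(BX)` cancels in `I(B:X) + I(R⟩BX)`, which leaves `S(B) - S(BRX) + S(X)`. The first two terms
are the coherent information from `RX` to `B`; the associator groups `R` and `X` into one system. -/
theorem generalizedInfo_eq [Fintype X] [DecidableEq X] [DecidableEq B] [DecidableEq R]
    (N : Matrix A A ℂ →ₗ[ℂ] Matrix B B ℂ) {ρ : Matrix ((A × R) × X) ((A × R) × X) ℂ}
    (hσ : (tensorId (R × X) N (ρ.submatrix (Equiv.prodAssoc A R X).symm
      (Equiv.prodAssoc A R X).symm)).IsHermitian) :
    generalizedInfo ρ N =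
      entropy (traceSnd (tensorId (R × X) N (ρ.submatrix (Equiv.prodAssoc A R X).symm
        (Equiv.prodAssoc A R X).symm))) -
      entropy (tensorId (R × X) N (ρ.submatrix (Equiv.prodAssoc A R X).symm
        (Equiv.prodAssoc A R X).symm)) +
      entropy (traceFst (traceFst (regroup (tensorId X (tensorId R N) ρ)))) := by
  -- Up to the order of the tensor factors, `regroup` is the identity, and `tensorId X ∘ tensorId R`
  -- is `tensorId (R × X)`.
  let e : R × B × X ≃ B × R × X :=
    ⟨fun i => (i.2.1, i.1, i.2.2), fun i => (i.2.1, i.1, i.2.2), fun _ => rfl, fun _ => rfl⟩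
  have h1 : entropy (regroup (tensorId X (tensorId R N) ρ)) = _ := entropy_submatrix_equiv hσ e
  have h2 : traceSnd (traceFst (regroup (tensorId X (tensorId R N) ρ))) =
      traceSnd (tensorId (R × X) N (ρ.submatrix (Equiv.prodAssoc A R X).symm
        (Equiv.prodAssoc A R X).symm)) := by
    ext b b'
    simp only [traceSnd, traceFst, of_apply, Fintype.sum_prod_type]
    rw [Finset.sum_comm]
    rfl
  rw [generalizedInfo, mutualInfo, coherentInfo, h1, h2]
  ring

end GeneralizedInfo

end QInfo

end

theorem mainTheorem3 {A B C R X : Type*}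
    [Fintype A] [Fintype B] [DecidableEq B] [Fintype C] [DecidableEq C]
    [Fintype R] [DecidableEq R] [Fintype X] [DecidableEq X]
    (p : X → ℝ) (hp : ∀ x, 0 ≤ p x) (hp_sum : ∑ x, p x = 1)
    (ρ : X → Matrix (A × R) (A × R) ℂ) (hρ : ∀ x, QInfo.IsDensity (ρ x))
    (N₁ : Matrix A A ℂ →ₗ[ℂ] Matrix B B ℂ) (hN₁ : QInfo.IsChannel N₁)
    (N₂ : Matrix B B ℂ →ₗ[ℂ] Matrix C C ℂ) (hN₂ : QInfo.IsChannel N₂) :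
    QInfo.generalizedInfo (QInfo.cqState p ρ) (N₂ ∘ₗ N₁) ≤
      QInfo.generalizedInfo (QInfo.cqState p ρ) N₁ := by
  have hρ' := (QInfo.posSemidef_cqState hp fun x => (hρ x).1).submatrix
    (Equiv.prodAssoc A R X).symm
  have hτ := hN₁.posSemidef_tensorId hρ'
  have hτ' := hN₂.posSemidef_tensorId hτ
  have hN : QInfo.IsChannel (N₂ ∘ₗ N₁) :=
    ⟨fun k M hM => hN₂.1 k _ (hN₁.1 k M hM), fun M => (hN₂.2 _).trans (hN₁.2 M)⟩
  rw [QInfo.generalizedInfo_eq N₁ hτ.1, QInfo.generalizedInfo_eq (N₂ ∘ₗ N₁) hτ'.1,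
    QInfo.traceFst_traceFst_regroup_tensorId hN, QInfo.traceFst_traceFst_regroup_tensorId hN₁]
  exact add_le_add_left (QInfo.entropy_traceSnd_sub_entropy_tensorId_le hτ hN₂) _
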